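/- **Theorem (discrete error estimate for the TS$_4$ scheme).** Let $\Omega\subset\mathbb{R}^d$, $d\in\{2,3\}$, be open (for instance a domain with Lipschitz boundary), let $T>0$ and let $\varepsilon,\mu>0$ be constants. Let $\mathring H^1(\Omega)$, $\mathring H(\operatorname{curl};\Omega)$, $\mathring H(\operatorname{div};\Omega)$ be the closures of the smooth compactly supported fields on $\Omega$ in the respective graph norms; for $d=2$ the curl of $E$ is the scalar $\partial_1E_2-\partial_2E_1$, the magnetic field is scalar, its curl is $(\partial_2H,-\partial_1H)$, and $\mathring H(\operatorname{div};\Omega)$ means $L^2(\Omega)$. Write $\langle\cdot,\cdot\rangle$ for the $L^2(\Omega)$ inner product, $\langle u,v\rangle_\alpha=\langle\alpha u,v\rangle$ and $\|u\|_\alpha=\langle u,u\rangle_\alpha^{1/2}$ for $\alpha\in\{\varepsilon^{-1},\varepsilon,\mu\}$. Let $p\in C^5([0,T];\mathring H^1(\Omega))$, $E\in C^5([0,T];\mathring H(\operatorname{curl};\Omega))$, $H\in C^5([0,T];\mathring H(\operatorname{div};\Omega))$, with initial values $p_0,E_0,H_0$, satisfy for all $t\in(0,T]$ and all $\tilde p\in\mathring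 H^1(\Omega)$, $\tilde E\in\mathring H(\operatorname{curl};\Omega)$, $\tilde H\in\mathring H(\operatorname{div};\Omega)$ $$\langle\partial_tp,\tilde p\rangle-\langle\varepsilon E,\nabla\tilde p\rangle=0,\qquad \langle\nabla p,\tilde E\rangle+\langle\varepsilon\,\partial_tE,\tilde E\rangle-\langle H,\nabla\times\tilde E\rangle=0,\qquad \langle\mu\,\partial_tH,\tilde H\rangle+\langle\nabla\times E,\tilde H\rangle=0 .$$ Then there are $\Delta t_0>0$ and $C>0$ with the following property. Let $0<\Delta t\le\Delta t_0$, let $N\ge2$ be an integer with $(N-1)\Delta t\le T$, put $t^n=n\Delta t$, and let $p^n\in\mathring H^1(\Omega)$, $E^n\in\mathring H(\operatorname{curl};\Omega)$, $H^n\in\mathring H(\operatorname{div};\Omega)$, $n=0,\dots,N$, satisfy the two-step scheme TS$_4$: for $n=1,\dots,N-1$ and all $\tilde p,\tilde E,\tilde H$ as above, $$\Big\langle\varepsilon^{-1}\tfrac{p^{n+1}-p^{n-1}}{2\Delta t},\tilde p\Big\rangle-\tfrac16\big\langle E^{n+1}+4E^n+E^{n-1},\nabla\tilde p\big\rangle=0,$$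 $$\tfrac16\big\langle\nabla(p^{n+1}+4p^n+p^{n-1}),\tilde E\big\rangle+\Big\langle\varepsilon\tfrac{E^{n+1}-E^{n-1}}{2\Delta t},\tilde E\Big\rangle-\tfrac16\big\langle\nabla\times(H^{n+1}+4H^n+H^{n-1}),\tilde E\big\rangle=0,$$ $$\Big\langle\mu\tfrac{H^{n+1}-H^{n-1}}{2\Delta t},\tilde H\Big\rangle+\tfrac16\big\langle\nabla\times(E^{n+1}+4E^n+E^{n-1}),\tilde H\big\rangle=0,$$ where the weak curl in the second equation is required to exist in $L^2(\Omega)$. Let $e_p^n=p(t^n)-p^n$, $e_E^n=E(t^n)-E^n$, $e_H^n=H(t^n)-H^n$, and assume the positivity of the inner products: $$\langle e_p^{n+1},e_p^n\rangle_{\varepsilon^{-1}}\ge0,\qquad\langle e_E^{n+1},e_E^n\rangle_{\varepsilon}\ge0,\qquad\langle e_H^{n+1},e_H^n\rangle_{\mu}\ge0\qquad(0\le n\le N-2).$$ Then $$\|e_p^{N-1}\|_{\varepsilon^{-1}}+\|e_E^{N-1}\|_{\varepsilon}+\|e_H^{N-1}\|_{\mu}\le C\Big[(\Delta t)^4+\|e_p^0\|_{\varepsilon^{-1}}+\|e_E^0\|_{\varepsilon}+\|e_H^0\|_{\mu}+\|e_p^1\|_{\varepsilon^{-1}}+\|e_E^1\|_{\varepsilon}+\|e_H^1\|_{\mu}\Big].$$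 The constant $C$ depends on neither $\Delta t$, $N$ nor the discrete solution. -/

import Mathlib

open MeasureTheory Set
open scoped ContDiff

noncomputable section

namespace MaxwellTS4

/-- The space dimension: the domain lies in the plane or in three-dimensional space. -/
inductive SpaceDim
  | two
  | three

/-- The number of coordinates of a point, and of components of the electric field. -/
abbrev SpaceDim.dim : SpaceDim → ℕ
  | .two => 2
  | .three => 3

/-- The number of components of the magnetic field. In the plane the magnetic field is
perpendicular to the plane, so it has a single component. -/
abbrev SpaceDim.magDim : SpaceDim → ℕ
  | .two => 1
  | .three => 3

/-- Vectors with `n` real components, with the Euclidean norm. -/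
abbrev Vec (n : ℕ) : Type := EuclideanSpace ℝ (Fin n)

/-- Points of the plane or of space. -/
abbrev Point (D : SpaceDim) : Type := Vec D.dim

/-- The partial derivative of the `j`-th component of `u` in direction `i`, at the point `x`. -/
def pd {m n : ℕ} (i : Fin m) (u : Vec m → Vec n) (j : Fin n) (x : Vec m) : ℝ :=
  fderiv ℝ u x (EuclideanSpace.single i 1) j

/-- The classical curl of a smooth field with the components of an electric field: the scalar curl
in the plane, the usual curl in space. -/
def curl : (D : SpaceDim) → (Point D → Vec D.dim) → Point D → Vec D.magDim
  | .two, u, x => !₂[pd (0 : Fin 2) u (1 : Fin 2) x - pd (1 : Fin 2) u (0 : Fin 2) x]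
  | .three, u, x =>
      !₂[pd (1 : Fin 3) u (2 : Fin 3) x - pd (2 : Fin 3) u (1 : Fin 3) x,
         pd (2 : Fin 3) u (0 : Fin 3) x - pd (0 : Fin 3) u (2 : Fin 3) x,
         pd (0 : Fin 3) u (1 : Fin 3) x - pd (1 : Fin 3) u (0 : Fin 3) x]

/-- The classical divergence of a smooth field with the components of a magnetic field. In the
plane, a field perpendicular to the plane (and depending on the two planar coordinates only) has
divergence zero. -/
def divergence : (D : SpaceDim) → (Point D → Vec D.magDim) → Point D → ℝ
  | .two, _, _ => 0
  | .three, u, x =>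
      pd (0 : Fin 3) u (0 : Fin 3) x + pd (1 : Fin 3) u (1 : Fin 3) x
        + pd (2 : Fin 3) u (2 : Fin 3) x

/-- `φ` is a smooth field with compact support contained in `Ω`. -/
structure IsTestField {D : SpaceDim} {V : Type} [NormedAddCommGroup V] [NormedSpace ℝ V]
    (Ω : Set (Point D)) (φ : Point D → V) : Prop where
  smooth : ContDiff ℝ ∞ φ
  compact : HasCompactSupport φ
  supp : tsupport φ ⊆ Ω

/-- Square integrable fields on `Ω` with values in `V`. -/
abbrev L2 {D : SpaceDim} (V : Type) [NormedAddCommGroup V] (Ω : Set (Point D)) : Type :=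
  Lp V 2 (volume.restrict Ω)

/-- The closure, in the graph norm of the first order differential operator `A`, of the test fields
on `Ω`. Its elements are the pairs `(u, A u)`, where `A` acts in the weak sense on `u`. (The pairs
`(φ, A φ)` with `φ` a test field already form a linear space if `A` is linear, so that the span
adds nothing.) The norm is the maximum of the `L²` norms of `u` and `A u`, which is equivalent to
the Hilbert graph norm and, for positive constants as weights, to every weighted graph norm. -/
def graphClosure {D : SpaceDim} {V W : Type} [NormedAddCommGroup V] [NormedSpace ℝ V]
    [NormedAddCommGroup W] [NormedSpace ℝ W] (Ω : Set (Point D))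
    (A : (Point D → V) → Point D → W) : Submodule ℝ (L2 V Ω × L2 W Ω) :=
  (Submodule.span ℝ {z : L2 V Ω × L2 W Ω | ∃ φ : Point D → V, IsTestField Ω φ ∧
    z.1 =ᵐ[volume.restrict Ω] φ ∧ z.2 =ᵐ[volume.restrict Ω] A φ}).topologicalClosure

/-- The space `H̊¹(Ω)` of the pressure. -/
abbrev H1Zero (D : SpaceDim) (Ω : Set (Point D)) : Submodule ℝ (L2 ℝ Ω × L2 (Vec D.dim) Ω) :=
  graphClosure Ω gradient

/-- The space `H̊(curl; Ω)` of the electric field. -/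
abbrev HCurlZero (D : SpaceDim) (Ω : Set (Point D)) :
    Submodule ℝ (L2 (Vec D.dim) Ω × L2 (Vec D.magDim) Ω) :=
  graphClosure Ω (curl D)

/-- The space `H̊(div; Ω)` of the magnetic field. For a planar domain this is `L²(Ω)`. -/
abbrev HDivZero (D : SpaceDim) (Ω : Set (Point D)) : Submodule ℝ (L2 (Vec D.magDim) Ω × L2 ℝ Ω) :=
  graphClosure Ω (divergence D)

section Components

variable {D : SpaceDim} {Ω : Set (Point D)}

/-- The underlying `L²` field of an element of one of the three spaces. -/
def fld {V W : Type} [NormedAddCommGroup V] [NormedSpace ℝ V] [NormedAddCommGroup W]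
    [NormedSpace ℝ W] {A : (Point D → V) → Point D → W} (u : graphClosure Ω A) : L2 V Ω :=
  u.1.1

/-- The weak gradient of an element of `H̊¹(Ω)`. -/
def wgrad (u : H1Zero D Ω) : L2 (Vec D.dim) Ω := u.1.2

/-- The weak curl of an element of `H̊(curl; Ω)`. -/
def wcurl (u : HCurlZero D Ω) : L2 (Vec D.magDim) Ω := u.1.2

/-- The field `c` is the weak curl of the field `h`, where `h` has the components of a magnetic
field: `∫ c · φ = ∫ h · curl φ` for all test fields `φ`. In the plane this means that
`c = (∂₂ h, - ∂₁ h)`. -/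
def IsWeakCurl (h : L2 (Vec D.magDim) Ω) (c : L2 (Vec D.dim) Ω) : Prop :=
  ∀ φ : Point D → Vec D.dim, IsTestField Ω φ →
    ∫ x in Ω, inner ℝ (c x) (φ x) = ∫ x in Ω, inner ℝ (h x) (curl D φ x)

/-- The weighted inner product `⟨u, v⟩_α = ⟨α u, v⟩` of `L²(Ω)`. -/
def winner {V : Type} [NormedAddCommGroup V] [InnerProductSpace ℝ V] (α : ℝ) (u v : L2 V Ω) : ℝ :=
  inner ℝ (α • u) v

/-- The weighted norm `‖u‖_α = ⟨u, u⟩_α ^ (1/2)` of `L²(Ω)`. -/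
def wnorm {V : Type} [NormedAddCommGroup V] [InnerProductSpace ℝ V] (α : ℝ) (u : L2 V Ω) : ℝ :=
  Real.sqrt (winner α u u)

/-- `(p, E, H)` solves the variational three-field Maxwell system on `Ω × (0, T]` with the initial
values `p₀`, `E₀`, `H₀`. (Time derivatives are taken in the respective function spaces, one-sided
at the end points of `[0, T]`.) -/
structure IsMaxwellSolution (ε μ T : ℝ) (p₀ : H1Zero D Ω) (E₀ : HCurlZero D Ω)
    (H₀ : HDivZero D Ω) (p : ℝ → H1Zero D Ω) (E : ℝ → HCurlZero D Ω)
    (H : ℝ → HDivZero D Ω) : Prop where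
  initial_p : p 0 = p₀
  initial_E : E 0 = E₀
  initial_H : H 0 = H₀
  eq_p : ∀ t ∈ Ioc 0 T, ∀ q : H1Zero D Ω,
    inner ℝ (fld (derivWithin p (Icc 0 T) t)) (fld q) - inner ℝ (ε • fld (E t)) (wgrad q) = 0
  eq_E : ∀ t ∈ Ioc 0 T, ∀ F : HCurlZero D Ω,
    inner ℝ (wgrad (p t)) (fld F) + inner ℝ (ε • fld (derivWithin E (Icc 0 T) t)) (fld F)
      - inner ℝ (fld (H t)) (wcurl F) = 0
  eq_H : ∀ t ∈ Ioc 0 T, ∀ G : HDivZero D Ω,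
    inner ℝ (μ • fld (derivWithin H (Icc 0 T) t)) (fld G) + inner ℝ (wcurl (E t)) (fld G) = 0

/-- `(pⁿ, Eⁿ, Hⁿ)`, `n = 0, …, N`, solves the time-semidiscrete scheme TS₄ with time step `τ`: the
equations hold at all the central indices `n + 1 = 1, …, N - 1`. In the second equation it is part
of the requirement that the combination of the magnetic fields has a square integrable weak
curl. -/
structure IsTS4Solution (ε μ τ : ℝ) (N : ℕ) (p : ℕ → H1Zero D Ω) (E : ℕ → HCurlZero D Ω)
    (H : ℕ → HDivZero D Ω) : Prop where
  eq_p : ∀ n : ℕ, n + 2 ≤ N → ∀ q : H1Zero D Ω,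
    inner ℝ (ε⁻¹ • (1 / (2 * τ)) • fld (p (n + 2) - p n)) (fld q)
      - 1 / 6 * inner ℝ (fld (E (n + 2) + (4 : ℝ) • E (n + 1) + E n)) (wgrad q) = 0
  eq_E : ∀ n : ℕ, n + 2 ≤ N → ∃ c : L2 (Vec D.dim) Ω,
    IsWeakCurl (fld (H (n + 2) + (4 : ℝ) • H (n + 1) + H n)) c ∧
    ∀ F : HCurlZero D Ω,
      1 / 6 * inner ℝ (wgrad (p (n + 2) + (4 : ℝ) • p (n + 1) + p n)) (fld F)
        + inner ℝ (ε • (1 / (2 * τ)) • fld (E (n + 2) - E n)) (fld F)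
        - 1 / 6 * inner ℝ c (fld F) = 0
  eq_H : ∀ n : ℕ, n + 2 ≤ N → ∀ G : HDivZero D Ω,
    inner ℝ (μ • (1 / (2 * τ)) • fld (H (n + 2) - H n)) (fld G)
      + 1 / 6 * inner ℝ (wcurl (E (n + 2) + (4 : ℝ) • E (n + 1) + E n)) (fld G) = 0

/-- The error `u(tⁿ) - uⁿ` at time `tⁿ = n τ`, as an `L²` field. -/
def err {V W : Type} [NormedAddCommGroup V] [NormedSpace ℝ V] [NormedAddCommGroup W]
    [NormedSpace ℝ W] {A : (Point D → V) → Point D → W} (τ : ℝ) (u : ℝ → graphClosure Ω A)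
    (U : ℕ → graphClosure Ω A) (n : ℕ) : L2 V Ω :=
  fld (u (n * τ)) - fld (U n)

/-- Positivity of the inner products: the `α`-inner product of the errors `e` at any two consecutive
steps among `0, …, N - 1` is nonnegative. -/
def PositiveInnerProducts {V : Type} [NormedAddCommGroup V] [InnerProductSpace ℝ V] (α : ℝ) (N : ℕ)
    (e : ℕ → L2 V Ω) : Prop :=
  ∀ n : ℕ, n + 1 ≤ N - 1 → 0 ≤ winner α (e (n + 1)) (e n)

end Components

end MaxwellTS4

end

open MaxwellTS4

open MaxwellTS4

open Finset in
/-- Taylor's theorem with a crude remainder bound, uniform in the base point, for a chain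
`f 0, f 1, …` of successive derivatives. -/
theorem norm_sub_taylor_sum_le {X : Type*} [NormedAddCommGroup X] [NormedSpace ℝ X] {T M : ℝ}
    (n : ℕ) (f : ℕ → ℝ → X)
    (hf : ∀ k < n, ∀ x ∈ Icc 0 T, HasDerivWithinAt (f k) (f (k + 1) x) (Icc 0 T) x)
    (hM : ∀ x ∈ Icc 0 T, ‖f n x‖ ≤ M) {a x : ℝ} (ha : 0 ≤ a) (hax : a ≤ x) (hx : x ≤ T) :
    ‖f 0 x - ∑ k ∈ range n, ((x - a) ^ k / (k.factorial : ℝ)) • f k a‖ ≤ M * (x - a) ^ n := by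
  induction n generalizing f x with
  | zero => simpa using hM x ⟨ha.trans hax, hx⟩
  | succ n ih =>
    have hsub : Icc a x ⊆ Icc 0 T := Icc_subset_Icc ha hx
    have hM0 : 0 ≤ M := (norm_nonneg _).trans (hM x ⟨ha.trans hax, hx⟩)
    have hpow : ∀ (k : ℕ) (y : ℝ), HasDerivWithinAt
        (fun y => ((y - a) ^ (k + 1) / ((k + 1).factorial : ℝ)) • f (k + 1) a)
        (((y - a) ^ k / (k.factorial : ℝ)) • f (k + 1) a) (Icc a x) y := by
      intro k y
      have h := ((((hasDerivAt_id y).sub_const a).pow (k + 1)).div_const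
        ((k + 1).factorial : ℝ)).smul_const (f (k + 1) a)
      refine (h.congr_deriv ?_).hasDerivWithinAt
      congr 1
      rw [Nat.factorial_succ]
      push_cast
      simp only [id]
      field_simp
    have hder : ∀ y ∈ Icc a x, HasDerivWithinAt
        (fun y => f 0 y - ∑ k ∈ range (n + 1), ((y - a) ^ k / (k.factorial : ℝ)) • f k a)
        (f 1 y - ∑ k ∈ range n, ((y - a) ^ k / (k.factorial : ℝ)) • f (k + 1) a)
        (Icc a x) y := by
      intro y hy
      have h0 := (hf 0 n.succ_pos y (hsub hy)).mono hsub
      have h1 : HasDerivWithinAt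
          (fun y => ∑ k ∈ range n,
            ((y - a) ^ (k + 1) / ((k + 1).factorial : ℝ)) • f (k + 1) a)
          (∑ k ∈ range n, ((y - a) ^ k / (k.factorial : ℝ)) • f (k + 1) a) (Icc a x) y :=
        HasDerivWithinAt.fun_sum fun k _ => hpow k y
      simpa [sum_range_succ', sub_add_eq_sub_sub] using (h0.sub h1).sub_const (f 0 a)
    have hbound : ∀ y ∈ Icc a x,
        ‖f 1 y - ∑ k ∈ range n, ((y - a) ^ k / (k.factorial : ℝ)) • f (k + 1) a‖
          ≤ M * (x - a) ^ n := by
      intro y hy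
      have h := ih (fun k => f (k + 1)) (fun k hk => hf (k + 1) (by omega)) hM hy.1
        (hy.2.trans hx)
      have := hy.1
      have := hy.2
      refine h.trans ?_
      gcongr
    have h := (convex_Icc a x).norm_image_sub_le_of_norm_hasDerivWithin_le hder hbound
      (left_mem_Icc.2 hax) (right_mem_Icc.2 hax)
    have hz : f 0 a - ∑ k ∈ range (n + 1), ((a - a) ^ k / (k.factorial : ℝ)) • f k a = 0 := by
      simp [sum_range_succ']
    rw [hz, sub_zero, Real.norm_of_nonneg (sub_nonneg.2 hax)] at h
    rw [pow_succ, ← mul_assoc]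
    exact h

/-- The error of Simpson's rule for the derivative of a `C⁵` function is of fifth order. -/
theorem exists_simpson_error_bound {X : Type*} [NormedAddCommGroup X] [NormedSpace ℝ X] {T : ℝ}
    (hT : 0 < T) {u : ℝ → X} (hu : ContDiffOn ℝ 5 u (Icc 0 T)) :
    ∃ K : ℝ, 0 ≤ K ∧ ∀ a h : ℝ, 0 ≤ a → 0 ≤ h → a + 2 * h ≤ T →
      ‖u (a + 2 * h) - u a - (h / 3) • (derivWithin u (Icc 0 T) (a + 2 * h)
        + (4 : ℝ) • derivWithin u (Icc 0 T) (a + h) + derivWithin u (Icc 0 T) a)‖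
        ≤ K * h ^ 5 := by
  have hS := uniqueDiffOn_Icc hT
  set f : ℕ → ℝ → X := fun k => iteratedDerivWithin k u (Icc 0 T) with hfdef
  have hf : ∀ k < 5, ∀ x ∈ Icc 0 T, HasDerivWithinAt (f k) (f (k + 1) x) (Icc 0 T) x := by
    intro k hk x hx
    have h := (hu.differentiableOn_iteratedDerivWithin (m := k) (by exact_mod_cast hk) hS x
      hx).hasDerivWithinAt
    rwa [← iteratedDerivWithin_succ] at h
  have h0 : f 0 = u := iteratedDerivWithin_zero
  have h1 : f 1 = derivWithin u (Icc 0 T) := iteratedDerivWithin_one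
  obtain ⟨M, hM⟩ := isCompact_Icc.exists_bound_of_continuousOn
    (hu.continuousOn_iteratedDerivWithin (m := 5) le_rfl hS)
  have hM0 : 0 ≤ M := (norm_nonneg _).trans (hM 0 ⟨le_rfl, hT.le⟩)
  refine ⟨116 / 3 * M, by positivity, fun a h ha hh hT' => ?_⟩
  rw [← h1, ← h0]
  have hf' : ∀ k < 4, ∀ x ∈ Icc 0 T,
      HasDerivWithinAt (f (k + 1)) (f (k + 1 + 1) x) (Icc 0 T) x :=
    fun k hk => hf (k + 1) (by omega)
  have e0 := norm_sub_taylor_sum_le 5 f hf hM (x := a + 2 * h) ha (by linarith) hT'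
  have e1 := norm_sub_taylor_sum_le 4 (fun k => f (k + 1)) hf' hM (x := a + 2 * h) ha
    (by linarith) hT'
  have e2 := norm_sub_taylor_sum_le 4 (fun k => f (k + 1)) hf' hM (x := a + h) ha
    (by linarith) (by linarith)
  set r0 := f 0 (a + 2 * h)
    - ∑ k ∈ Finset.range 5, ((a + 2 * h - a) ^ k / (k.factorial : ℝ)) • f k a with hr0
  set r1 := f (0 + 1) (a + 2 * h)
    - ∑ k ∈ Finset.range 4, ((a + 2 * h - a) ^ k / (k.factorial : ℝ)) • f (k + 1) a with hr1
  set r2 := f (0 + 1) (a + h)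
    - ∑ k ∈ Finset.range 4, ((a + h - a) ^ k / (k.factorial : ℝ)) • f (k + 1) a with hr2
  have key : f 0 (a + 2 * h) - f 0 a
      - (h / 3) • (f 1 (a + 2 * h) + (4 : ℝ) • f 1 (a + h) + f 1 a)
      = r0 - (h / 3) • r1 - (4 * h / 3) • r2 := by
    rw [hr0, hr1, hr2]
    simp only [Finset.sum_range_succ, Finset.sum_range_zero, Nat.factorial, add_sub_cancel_left]
    push_cast
    module
  have hh1 : ‖(h / 3) • r1‖ ≤ h / 3 * (M * (a + 2 * h - a) ^ 4) := by
    rw [norm_smul, Real.norm_of_nonneg (by positivity)]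
    gcongr
  have hh2 : ‖(4 * h / 3) • r2‖ ≤ 4 * h / 3 * (M * (a + h - a) ^ 4) := by
    rw [norm_smul, Real.norm_of_nonneg (by positivity)]
    gcongr
  rw [key]
  calc ‖r0 - (h / 3) • r1 - (4 * h / 3) • r2‖
      ≤ ‖r0‖ + ‖(h / 3) • r1‖ + ‖(4 * h / 3) • r2‖ :=
        (norm_sub_le _ _).trans (by gcongr; exact norm_sub_le _ _)
    _ ≤ M * (a + 2 * h - a) ^ 5 + h / 3 * (M * (a + 2 * h - a) ^ 4)
        + 4 * h / 3 * (M * (a + h - a) ^ 4) := by gcongr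
    _ = 116 / 3 * M * h ^ 5 := by ring

section Energy

variable {X : Type*} [NormedAddCommGroup X] [InnerProductSpace ℝ X]

/-- The energy of two consecutive steps of a two-step scheme of Simpson type. -/
noncomputable def stepEnergy (α : ℝ) (x y : X) : ℝ := α * (‖x‖ ^ 2 + ‖y‖ ^ 2 + 4 * inner ℝ y x)

theorem stepEnergy_sub (α : ℝ) (x y z : X) :
    stepEnergy α y z - stepEnergy α x y = α * inner ℝ (z - x) (z + (4 : ℝ) • y + x) := by
  simp only [stepEnergy, inner_sub_left, inner_add_right, inner_smul_right,
    real_inner_self_eq_norm_sq]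
  rw [real_inner_comm x z, real_inner_comm x y]
  ring

theorem sq_le_stepEnergy {α : ℝ} (hα : 0 ≤ α) {x y : X} (h : 0 ≤ α * inner ℝ y x) :
    (√α * ‖x‖) ^ 2 ≤ stepEnergy α x y ∧ (√α * ‖y‖) ^ 2 ≤ stepEnergy α x y := by
  simp only [stepEnergy, mul_pow, Real.sq_sqrt hα]
  have hx : 0 ≤ α * ‖x‖ ^ 2 := by positivity
  have hy : 0 ≤ α * ‖y‖ ^ 2 := by positivity
  constructor <;> nlinarith

theorem stepEnergy_le {α : ℝ} (hα : 0 ≤ α) (x y : X) :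
    stepEnergy α x y ≤ 3 * ((√α * ‖x‖) ^ 2 + (√α * ‖y‖) ^ 2) := by
  simp only [stepEnergy, mul_pow, Real.sq_sqrt hα]
  have h : 4 * inner ℝ y x ≤ 2 * ‖x‖ ^ 2 + 2 * ‖y‖ ^ 2 := by
    nlinarith [real_inner_le_norm y x, sq_nonneg (‖x‖ - ‖y‖)]
  nlinarith [mul_le_mul_of_nonneg_left h hα]

theorem mul_inner_comb_le {α s s' : ℝ} (hα : 0 ≤ α) (r x y z : X) (hx : √α * ‖x‖ ≤ s)
    (hy : √α * ‖y‖ ≤ s) (hy' : √α * ‖y‖ ≤ s') (hz : √α * ‖z‖ ≤ s') :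
    α * inner ℝ r (z + (4 : ℝ) • y + x) ≤ √α * ‖r‖ * (3 * (s + s')) := by
  have h1 : ‖z + (4 : ℝ) • y + x‖ ≤ ‖z‖ + 4 * ‖y‖ + ‖x‖ := by
    refine (norm_add₃_le).trans_eq ?_
    rw [norm_smul, Real.norm_of_nonneg (by norm_num)]
  calc α * inner ℝ r (z + (4 : ℝ) • y + x)
      ≤ α * (‖r‖ * (‖z‖ + 4 * ‖y‖ + ‖x‖)) := by
        gcongr
        exact (real_inner_le_norm _ _).trans (by gcongr)
    _ = √α * ‖r‖ * (√α * ‖z‖ + 4 * (√α * ‖y‖) + √α * ‖x‖) := by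
        nth_rewrite 1 [← Real.mul_self_sqrt hα]
        ring
    _ ≤ √α * ‖r‖ * (3 * (s + s')) := by
        gcongr
        linarith

end Energy

theorem sub_le_of_sq_sub_sq_le {a b k : ℝ} (hb : 0 ≤ b) (hk : 0 ≤ k)
    (h : a ^ 2 - b ^ 2 ≤ k * (b + a)) : a - b ≤ k := by
  by_contra! hc
  have : 0 < b + a := by linarith
  nlinarith

theorem sum_sq_le_sq_sum {a b c a' b' c' : ℝ} (ha : 0 ≤ a) (hb : 0 ≤ b) (hc : 0 ≤ c)
    (ha' : 0 ≤ a') (hb' : 0 ≤ b') (hc' : 0 ≤ c') :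
    a ^ 2 + a' ^ 2 + (b ^ 2 + b' ^ 2) + (c ^ 2 + c' ^ 2)
      ≤ (a + b + c + a' + b' + c') ^ 2 := by
  rw [← sub_nonneg]
  ring_nf
  positivity

/-- Stability of a two-step scheme with three components of Simpson type: a perturbed energy
identity bounds the last step by the first two steps and the accumulated defects. -/
theorem norm_le_of_stepEnergy_identity {X Y Z : Type*} [NormedAddCommGroup X]
    [InnerProductSpace ℝ X] [NormedAddCommGroup Y] [InnerProductSpace ℝ Y] [NormedAddCommGroup Z]
    [InnerProductSpace ℝ Z] {α β γ k : ℝ} (hα : 0 ≤ α) (hβ : 0 ≤ β) (hγ : 0 ≤ γ)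
    {x r : ℕ → X} {y s : ℕ → Y} {z t : ℕ → Z} {m : ℕ}
    (hx : ∀ n ≤ m, 0 ≤ α * inner ℝ (x (n + 1)) (x n))
    (hy : ∀ n ≤ m, 0 ≤ β * inner ℝ (y (n + 1)) (y n))
    (hz : ∀ n ≤ m, 0 ≤ γ * inner ℝ (z (n + 1)) (z n))
    (hk : ∀ n < m, √α * ‖r n‖ + √β * ‖s n‖ + √γ * ‖t n‖ ≤ k)
    (hid : ∀ n < m,
      (stepEnergy α (x (n + 1)) (x (n + 2)) - stepEnergy α (x n) (x (n + 1)))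
        + (stepEnergy β (y (n + 1)) (y (n + 2)) - stepEnergy β (y n) (y (n + 1)))
        + (stepEnergy γ (z (n + 1)) (z (n + 2)) - stepEnergy γ (z n) (z (n + 1)))
      = α * inner ℝ (r n) (x (n + 2) + (4 : ℝ) • x (n + 1) + x n)
        + β * inner ℝ (s n) (y (n + 2) + (4 : ℝ) • y (n + 1) + y n)
        + γ * inner ℝ (t n) (z (n + 2) + (4 : ℝ) • z (n + 1) + z n)) :
    √α * ‖x (m + 1)‖ + √β * ‖y (m + 1)‖ + √γ * ‖z (m + 1)‖
      ≤ 3 * (2 * (√α * ‖x 0‖ + √β * ‖y 0‖ + √γ * ‖z 0‖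
        + √α * ‖x 1‖ + √β * ‖y 1‖ + √γ * ‖z 1‖) + m * (3 * k)) := by
  obtain ⟨Q, hQ⟩ : ∃ Q : ℕ → ℝ, ∀ n, Q n = stepEnergy α (x n) (x (n + 1))
    + stepEnergy β (y n) (y (n + 1)) + stepEnergy γ (z n) (z (n + 1)) := ⟨_, fun _ => rfl⟩
  have hle : ∀ n ≤ m, 0 ≤ Q n ∧
      (√α * ‖x n‖ ≤ √(Q n) ∧ √α * ‖x (n + 1)‖ ≤ √(Q n)) ∧
      (√β * ‖y n‖ ≤ √(Q n) ∧ √β * ‖y (n + 1)‖ ≤ √(Q n)) ∧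
      (√γ * ‖z n‖ ≤ √(Q n) ∧ √γ * ‖z (n + 1)‖ ≤ √(Q n)) := by
    intro n hn
    obtain ⟨a1, a2⟩ := sq_le_stepEnergy hα (hx n hn)
    obtain ⟨b1, b2⟩ := sq_le_stepEnergy hβ (hy n hn)
    obtain ⟨c1, c2⟩ := sq_le_stepEnergy hγ (hz n hn)
    have a0 := (sq_nonneg _).trans a1
    have b0 := (sq_nonneg _).trans b1
    have c0 := (sq_nonneg _).trans c1
    have hQn := hQ n
    refine ⟨by linarith, ⟨?_, ?_⟩, ⟨?_, ?_⟩, ?_, ?_⟩ <;> apply Real.le_sqrt_of_sq_le <;>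
      linarith
  have hstep : ∀ n < m, √(Q (n + 1)) ≤ √(Q n) + 3 * k := by
    intro n hn
    obtain ⟨q0, ⟨x0, x1⟩, ⟨y0, y1⟩, z0, z1⟩ := hle n hn.le
    obtain ⟨q0', ⟨x1', x2⟩, ⟨y1', y2⟩, z1', z2⟩ := hle (n + 1) hn
    have ix := mul_inner_comb_le hα (r n) _ _ _ x0 x1 x1' x2
    have iy := mul_inner_comb_le hβ (s n) _ _ _ y0 y1 y1' y2
    have iz := mul_inner_comb_le hγ (t n) _ _ _ z0 z1 z1' z2
    have hs : 0 ≤ 3 * (√(Q n) + √(Q (n + 1))) := by positivity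
    have hk0 : 0 ≤ k := le_trans (by positivity) (hk n hn)
    have hkn := mul_le_mul_of_nonneg_right (hk n hn) hs
    have hdiff : √(Q (n + 1)) ^ 2 - √(Q n) ^ 2 ≤ 3 * k * (√(Q n) + √(Q (n + 1))) := by
      rw [Real.sq_sqrt q0, Real.sq_sqrt q0']
      have h := hid n hn
      rw [show n + 2 = n + 1 + 1 from rfl] at h
      linarith [hQ n, hQ (n + 1)]
    linarith [sub_le_of_sq_sub_sq_le (Real.sqrt_nonneg _) (by positivity) hdiff]
  have hind : ∀ n ≤ m, √(Q n) ≤ √(Q 0) + n * (3 * k) := by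
    intro n
    induction n with
    | zero => simp
    | succ n ih =>
      intro hn
      have h1 := ih (by omega)
      have h2 := hstep n hn
      push_cast
      linarith
  obtain ⟨-, ⟨-, xm⟩, ⟨-, ym⟩, -, zm⟩ := hle m le_rfl
  have hm := hind m le_rfl
  have hQ0 : √(Q 0) ≤ 2 * (√α * ‖x 0‖ + √β * ‖y 0‖ + √γ * ‖z 0‖
      + √α * ‖x 1‖ + √β * ‖y 1‖ + √γ * ‖z 1‖) := by
    refine Real.sqrt_le_iff.2 ⟨by positivity, ?_⟩
    have h1 := stepEnergy_le hα (x 0) (x 1)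
    have h2 := stepEnergy_le hβ (y 0) (y 1)
    have h3 := stepEnergy_le hγ (z 0) (z 1)
    have hsq := sum_sq_le_sq_sum (a := √α * ‖x 0‖) (b := √β * ‖y 0‖) (c := √γ * ‖z 0‖)
      (a' := √α * ‖x 1‖) (b' := √β * ‖y 1‖) (c' := √γ * ‖z 1‖) (by positivity) (by positivity)
      (by positivity) (by positivity) (by positivity) (by positivity)
    rw [hQ 0, mul_pow, zero_add]
    linarith [sq_nonneg (√α * ‖x 0‖ + √β * ‖y 0‖ + √γ * ‖z 0‖
      + √α * ‖x 1‖ + √β * ‖y 1‖ + √γ * ‖z 1‖)]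
  linarith

section Fields

variable {D : SpaceDim} {Ω : Set (Point D)} {V W : Type}
  [NormedAddCommGroup V] [NormedAddCommGroup W]

section Normed

variable [NormedSpace ℝ V] [NormedSpace ℝ W]

/-- The underlying field, as a continuous linear map. -/
noncomputable def fldL (A : (Point D → V) → Point D → W) : graphClosure Ω A →L[ℝ] L2 V Ω :=
  (ContinuousLinearMap.fst ℝ _ _).comp (graphClosure Ω A).subtypeL

/-- The weak derivative, as a continuous linear map. -/
noncomputable def wderivL (A : (Point D → V) → Point D → W) : graphClosure Ω A →L[ℝ] L2 W Ω :=
  (ContinuousLinearMap.snd ℝ _ _).comp (graphClosure Ω A).subtypeL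

theorem norm_fld_le {A : (Point D → V) → Point D → W} (u : graphClosure Ω A) :
    ‖fld u‖ ≤ ‖u‖ := norm_fst_le u.1

theorem fld_add {A : (Point D → V) → Point D → W} (u v : graphClosure Ω A) :
    fld (u + v) = fld u + fld v := rfl

theorem fld_sub {A : (Point D → V) → Point D → W} (u v : graphClosure Ω A) :
    fld (u - v) = fld u - fld v := rfl

theorem fld_smul {A : (Point D → V) → Point D → W} (c : ℝ) (u : graphClosure Ω A) :
    fld (c • u) = c • fld u := rfl

end Normed

theorem wgrad_add (u v : H1Zero D Ω) : wgrad (u + v) = wgrad u + wgrad v := rfl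

theorem wgrad_sub (u v : H1Zero D Ω) : wgrad (u - v) = wgrad u - wgrad v := rfl

theorem wgrad_smul (c : ℝ) (u : H1Zero D Ω) : wgrad (c • u) = c • wgrad u := rfl

theorem wcurl_add (u v : HCurlZero D Ω) : wcurl (u + v) = wcurl u + wcurl v := rfl

theorem wcurl_sub (u v : HCurlZero D Ω) : wcurl (u - v) = wcurl u - wcurl v := rfl

theorem wcurl_smul (c : ℝ) (u : HCurlZero D Ω) : wcurl (c • u) = c • wcurl u := rfl

theorem winner_eq [InnerProductSpace ℝ V] (α : ℝ) (u v : L2 V Ω) :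
    winner α u v = α * inner ℝ u v := real_inner_smul_left _ _ _

theorem wnorm_eq [InnerProductSpace ℝ V] {α : ℝ} (hα : 0 ≤ α) (u : L2 V Ω) :
    wnorm α u = √α * ‖u‖ := by
  rw [wnorm, winner_eq, real_inner_self_eq_norm_sq, Real.sqrt_mul hα,
    Real.sqrt_sq (norm_nonneg _)]

/-- The integration by parts that defines the weak curl extends from the test fields to
`H̊(curl; Ω)`. -/
theorem MaxwellTS4.IsWeakCurl.inner_fld {h : L2 (Vec D.magDim) Ω} {c : L2 (Vec D.dim) Ω}
    (hc : IsWeakCurl h c) (F : HCurlZero D Ω) :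
    inner ℝ c (fld F) = inner ℝ h (wcurl F) := by
  let ℓ : (L2 (Vec D.dim) Ω × L2 (Vec D.magDim) Ω) →L[ℝ] ℝ :=
    (innerSL ℝ c).comp (ContinuousLinearMap.fst ℝ _ _)
      - (innerSL ℝ h).comp (ContinuousLinearMap.snd ℝ _ _)
  have hle : HCurlZero D Ω ≤ ℓ.ker := by
    refine Submodule.topologicalClosure_minimal _ (Submodule.span_le.2 ?_) ℓ.isClosed_ker
    rintro z ⟨φ, hφ, h1, h2⟩
    change inner ℝ c z.1 - inner ℝ h z.2 = 0
    have e1 : inner ℝ c z.1 = ∫ x in Ω, inner ℝ (c x) (φ x) := by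
      rw [L2.inner_def]
      exact integral_congr_ae (h1.mono fun x hx => by simp only [hx])
    have e2 : inner ℝ h z.2 = ∫ x in Ω, inner ℝ (h x) (curl D φ x) := by
      rw [L2.inner_def]
      exact integral_congr_ae (h2.mono fun x hx => by simp only [hx])
    rw [e1, e2, hc φ hφ, sub_self]
  exact sub_eq_zero.1 (hle F.2)

end Fields

section Consistency

variable {D : SpaceDim} {Ω : Set (Point D)} {ε μ T : ℝ} {p₀ : H1Zero D Ω} {E₀ : HCurlZero D Ω}
  {H₀ : HDivZero D Ω} {p : ℝ → H1Zero D Ω} {E : ℝ → HCurlZero D Ω} {H : ℝ → HDivZero D Ω}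

theorem eq_zero_on_Icc (hT : 0 < T) {f : ℝ → ℝ} (hf : ContinuousOn f (Icc 0 T))
    (h : ∀ t ∈ Ioc 0 T, f t = 0) {t : ℝ} (ht : t ∈ Icc 0 T) : f t = 0 :=
  Set.EqOn.of_subset_closure (s := Ioc 0 T) (t := Icc 0 T) (f := f) (g := fun _ => 0) h hf
    continuousOn_const Ioc_subset_Icc_self (closure_Ioc hT.ne).ge ht

theorem continuousOn_derivWithin_Icc {X : Type*} [NormedAddCommGroup X] [NormedSpace ℝ X]
    (hT : 0 < T) {u : ℝ → X} (hu : ContDiffOn ℝ 5 u (Icc 0 T)) :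
    ContinuousOn (derivWithin u (Icc 0 T)) (Icc 0 T) :=
  hu.continuousOn_derivWithin (uniqueDiffOn_Icc hT) (by norm_num)

/-- The equation for the pressure holds up to the initial time. -/
theorem MaxwellTS4.IsMaxwellSolution.eq_p_Icc (hsol : IsMaxwellSolution ε μ T p₀ E₀ H₀ p E H) (hT : 0 < T)
    (hp : ContDiffOn ℝ 5 p (Icc 0 T)) (hE : ContDiffOn ℝ 5 E (Icc 0 T)) {t : ℝ}
    (ht : t ∈ Icc 0 T) (q : H1Zero D Ω) :
    inner ℝ (fld (derivWithin p (Icc 0 T) t)) (fld q) - inner ℝ (ε • fld (E t)) (wgrad q)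
      = 0 := by
  refine eq_zero_on_Icc (f := fun t => inner ℝ (fld (derivWithin p (Icc 0 T) t)) (fld q)
    - inner ℝ (ε • fld (E t)) (wgrad q)) hT ?_ (fun t ht => hsol.eq_p t ht q) ht
  have h1 := (fldL _).continuous.comp_continuousOn (continuousOn_derivWithin_Icc hT hp)
  have h2 := (fldL _).continuous.comp_continuousOn hE.continuousOn
  exact (h1.inner continuousOn_const).sub ((h2.const_smul ε).inner continuousOn_const)

/-- The equation for the electric field holds up to the initial time. -/
theorem MaxwellTS4.IsMaxwellSolution.eq_E_Icc (hsol : IsMaxwellSolution ε μ T p₀ E₀ H₀ p E H) (hT : 0 < T)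
    (hp : ContDiffOn ℝ 5 p (Icc 0 T)) (hE : ContDiffOn ℝ 5 E (Icc 0 T))
    (hH : ContDiffOn ℝ 5 H (Icc 0 T)) {t : ℝ} (ht : t ∈ Icc 0 T) (F : HCurlZero D Ω) :
    inner ℝ (wgrad (p t)) (fld F) + inner ℝ (ε • fld (derivWithin E (Icc 0 T) t)) (fld F)
      - inner ℝ (fld (H t)) (wcurl F) = 0 := by
  refine eq_zero_on_Icc (f := fun t => inner ℝ (wgrad (p t)) (fld F)
    + inner ℝ (ε • fld (derivWithin E (Icc 0 T) t)) (fld F)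
    - inner ℝ (fld (H t)) (wcurl F)) hT ?_ (fun t ht => hsol.eq_E t ht F) ht
  have h1 := (wderivL _).continuous.comp_continuousOn hp.continuousOn
  have h2 := (fldL _).continuous.comp_continuousOn (continuousOn_derivWithin_Icc hT hE)
  have h3 := (fldL _).continuous.comp_continuousOn hH.continuousOn
  exact ((h1.inner continuousOn_const).add ((h2.const_smul ε).inner continuousOn_const)).sub
    (h3.inner continuousOn_const)

/-- The equation for the magnetic field holds up to the initial time. -/
theorem MaxwellTS4.IsMaxwellSolution.eq_H_Icc (hsol : IsMaxwellSolution ε μ T p₀ E₀ H₀ p E H) (hT : 0 < T)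
    (hE : ContDiffOn ℝ 5 E (Icc 0 T)) (hH : ContDiffOn ℝ 5 H (Icc 0 T)) {t : ℝ}
    (ht : t ∈ Icc 0 T) (G : HDivZero D Ω) :
    inner ℝ (μ • fld (derivWithin H (Icc 0 T) t)) (fld G) + inner ℝ (wcurl (E t)) (fld G)
      = 0 := by
  refine eq_zero_on_Icc (f := fun t => inner ℝ (μ • fld (derivWithin H (Icc 0 T) t)) (fld G)
    + inner ℝ (wcurl (E t)) (fld G)) hT ?_ (fun t ht => hsol.eq_H t ht G) ht
  have h1 := (fldL _).continuous.comp_continuousOn (continuousOn_derivWithin_Icc hT hH)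
  have h2 := (wderivL _).continuous.comp_continuousOn hE.continuousOn
  exact ((h1.const_smul μ).inner continuousOn_const).add (h2.inner continuousOn_const)

/-- The defect of Simpson's rule over `[a, a + 2 h]` for the derivative of `u`. -/
noncomputable def simpsonDefect {X : Type*} [NormedAddCommGroup X] [NormedSpace ℝ X] (T : ℝ) (u : ℝ → X)
    (a h : ℝ) : X :=
  u (a + 2 * h) - u a - (h / 3) • (derivWithin u (Icc 0 T) (a + 2 * h)
    + (4 : ℝ) • derivWithin u (Icc 0 T) (a + h) + derivWithin u (Icc 0 T) a)

theorem sub_eq_simpsonDefect_add {X : Type*} [NormedAddCommGroup X] [NormedSpace ℝ X] (T : ℝ)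
    (u : ℝ → X) (a h : ℝ) : u (a + 2 * h) - u a = simpsonDefect T u a h
      + (h / 3) • (derivWithin u (Icc 0 T) (a + 2 * h)
        + (4 : ℝ) • derivWithin u (Icc 0 T) (a + h) + derivWithin u (Icc 0 T) a) := by
  rw [simpsonDefect, sub_add_cancel]

/-- The energy identity for the errors of one step: only the Simpson defects contribute, because
the spatial operator is skew-adjoint. -/
theorem energy_identity (hε : 0 < ε) (hT : 0 < T)
    (hsol : IsMaxwellSolution ε μ T p₀ E₀ H₀ p E H)
    (hp : ContDiffOn ℝ 5 p (Icc 0 T)) (hE : ContDiffOn ℝ 5 E (Icc 0 T))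
    (hH : ContDiffOn ℝ 5 H (Icc 0 T)) {τ : ℝ} (hτ : 0 < τ) {N : ℕ} {P : ℕ → H1Zero D Ω}
    {F : ℕ → HCurlZero D Ω} {G : ℕ → HDivZero D Ω} (hts : IsTS4Solution ε μ τ N P F G)
    {n : ℕ} (hn : n + 2 ≤ N) (hnT : ((n : ℝ) + 2) * τ ≤ T) :
    (stepEnergy ε⁻¹ (err τ p P (n + 1)) (err τ p P (n + 2))
        - stepEnergy ε⁻¹ (err τ p P n) (err τ p P (n + 1)))
      + (stepEnergy ε (err τ E F (n + 1)) (err τ E F (n + 2))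
        - stepEnergy ε (err τ E F n) (err τ E F (n + 1)))
      + (stepEnergy μ (err τ H G (n + 1)) (err τ H G (n + 2))
        - stepEnergy μ (err τ H G n) (err τ H G (n + 1)))
    = ε⁻¹ * inner ℝ (fld (simpsonDefect T p (n * τ) τ))
          (err τ p P (n + 2) + (4 : ℝ) • err τ p P (n + 1) + err τ p P n)
      + ε * inner ℝ (fld (simpsonDefect T E (n * τ) τ))
          (err τ E F (n + 2) + (4 : ℝ) • err τ E F (n + 1) + err τ E F n)
      + μ * inner ℝ (fld (simpsonDefect T H (n * τ) τ))
          (err τ H G (n + 2) + (4 : ℝ) • err τ H G (n + 1) + err τ H G n) := by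
  simp only [stepEnergy_sub]
  have hb : ((n + 1 : ℕ) : ℝ) * τ = n * τ + τ := by push_cast; ring
  have hc : ((n + 2 : ℕ) : ℝ) * τ = n * τ + 2 * τ := by push_cast; ring
  set a : ℝ := n * τ with ha
  have ha0 : 0 ≤ a := by positivity
  have hma : a ∈ Icc 0 T := ⟨ha0, by linarith⟩
  have hmb : a + τ ∈ Icc 0 T := ⟨by linarith, by linarith⟩
  have hmc : a + 2 * τ ∈ Icc 0 T := ⟨by linarith, by linarith⟩
  set q : H1Zero D Ω := (p (a + 2 * τ) - P (n + 2)) + (4 : ℝ) • (p (a + τ) - P (n + 1))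
    + (p a - P n) with hq
  set f : HCurlZero D Ω := (E (a + 2 * τ) - F (n + 2)) + (4 : ℝ) • (E (a + τ) - F (n + 1))
    + (E a - F n) with hf
  set g : HDivZero D Ω := (H (a + 2 * τ) - G (n + 2)) + (4 : ℝ) • (H (a + τ) - G (n + 1))
    + (H a - G n) with hg
  have hqe : err τ p P (n + 2) + (4 : ℝ) • err τ p P (n + 1) + err τ p P n = fld q := by
    simp only [err, hb, hc, ← ha]; rfl
  have hfe : err τ E F (n + 2) + (4 : ℝ) • err τ E F (n + 1) + err τ E F n = fld f := by
    simp only [err, hb, hc, ← ha]; rfl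
  have hge : err τ H G (n + 2) + (4 : ℝ) • err τ H G (n + 1) + err τ H G n = fld g := by
    simp only [err, hb, hc, ← ha]; rfl
  rw [hqe, hfe, hge]
  obtain ⟨c, hcw, hcE⟩ := hts.eq_E n hn
  have kp : ε⁻¹ * inner ℝ (err τ p P (n + 2) - err τ p P n) (fld q)
      = ε⁻¹ * inner ℝ (fld (simpsonDefect T p a τ)) (fld q)
        + τ / 3 * inner ℝ (fld f) (wgrad q) := by
    have s := hts.eq_p n hn q
    have ea := hsol.eq_p_Icc hT hp hE hma q
    have eb := hsol.eq_p_Icc hT hp hE hmb q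
    have ec := hsol.eq_p_Icc hT hp hE hmc q
    have hd : err τ p P (n + 2) - err τ p P n
        = fld (simpsonDefect T p a τ + (τ / 3) • (derivWithin p (Icc 0 T) (a + 2 * τ)
        + (4 : ℝ) • derivWithin p (Icc 0 T) (a + τ) + derivWithin p (Icc 0 T) a))
          - fld (P (n + 2) - P n) := by
      rw [← sub_eq_simpsonDefect_add]
      simp only [err, hc, ← ha, fld_sub]
      abel
    rw [hd, hf]
    clear_value q
    simp only [fld_add, fld_sub, fld_smul, inner_add_left, inner_sub_left,
      real_inner_smul_left] at s ea eb ec ⊢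
    field_simp at s ⊢
    linear_combination τ * (ec + 4 * eb + ea) - s / 2
  have kE : ε * inner ℝ (err τ E F (n + 2) - err τ E F n) (fld f)
      = ε * inner ℝ (fld (simpsonDefect T E a τ)) (fld f)
        - τ / 3 * inner ℝ (wgrad q) (fld f) + τ / 3 * inner ℝ (fld g) (wcurl f) := by
    have s := hcE f
    rw [hcw.inner_fld f] at s
    have ea := hsol.eq_E_Icc hT hp hE hH hma f
    have eb := hsol.eq_E_Icc hT hp hE hH hmb f
    have ec := hsol.eq_E_Icc hT hp hE hH hmc f
    have hd : err τ E F (n + 2) - err τ E F n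
        = fld (simpsonDefect T E a τ + (τ / 3) • (derivWithin E (Icc 0 T) (a + 2 * τ)
        + (4 : ℝ) • derivWithin E (Icc 0 T) (a + τ) + derivWithin E (Icc 0 T) a))
          - fld (F (n + 2) - F n) := by
      rw [← sub_eq_simpsonDefect_add]
      simp only [err, hc, ← ha, fld_sub]
      abel
    rw [hd, hq, hg]
    clear_value f
    simp only [fld_add, fld_sub, fld_smul, wgrad_add, wgrad_sub, wgrad_smul, inner_add_left,
      inner_sub_left, real_inner_smul_left] at s ea eb ec ⊢
    field_simp at s ⊢
    linear_combination τ * (ec + 4 * eb + ea) - s / 2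
  have kH : μ * inner ℝ (err τ H G (n + 2) - err τ H G n) (fld g)
      = μ * inner ℝ (fld (simpsonDefect T H a τ)) (fld g)
        - τ / 3 * inner ℝ (wcurl f) (fld g) := by
    have s := hts.eq_H n hn g
    have ea := hsol.eq_H_Icc hT hE hH hma g
    have eb := hsol.eq_H_Icc hT hE hH hmb g
    have ec := hsol.eq_H_Icc hT hE hH hmc g
    have hd : err τ H G (n + 2) - err τ H G n
        = fld (simpsonDefect T H a τ + (τ / 3) • (derivWithin H (Icc 0 T) (a + 2 * τ)
        + (4 : ℝ) • derivWithin H (Icc 0 T) (a + τ) + derivWithin H (Icc 0 T) a))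
          - fld (G (n + 2) - G n) := by
      rw [← sub_eq_simpsonDefect_add]
      simp only [err, hc, ← ha, fld_sub]
      abel
    rw [hd, hf]
    clear_value g
    simp only [fld_add, fld_sub, fld_smul, wcurl_add, wcurl_sub, wcurl_smul, inner_add_left,
      inner_sub_left, real_inner_smul_left] at s ea eb ec ⊢
    field_simp at s ⊢
    linear_combination τ * (ec + 4 * eb + ea) - s / 2
  rw [real_inner_comm (wgrad q)] at kp
  rw [real_inner_comm (wcurl f)] at kE
  linear_combination kp + kE + kH

end Consistency

theorem theorem3p2 (D : SpaceDim) (Ω : Set (Point D)) (hΩ : IsOpen Ω)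
    (ε μ T : ℝ) (hε : 0 < ε) (hμ : 0 < μ) (hT : 0 < T)
    (p₀ : H1Zero D Ω) (E₀ : HCurlZero D Ω) (H₀ : HDivZero D Ω)
    (p : ℝ → H1Zero D Ω) (E : ℝ → HCurlZero D Ω) (H : ℝ → HDivZero D Ω)
    (hsol : IsMaxwellSolution ε μ T p₀ E₀ H₀ p E H)
    (hp : ContDiffOn ℝ 5 p (Icc 0 T)) (hE : ContDiffOn ℝ 5 E (Icc 0 T))
    (hH : ContDiffOn ℝ 5 H (Icc 0 T)) :
    ∃ τ₀ : ℝ, 0 < τ₀ ∧ ∃ C : ℝ, 0 < C ∧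
      ∀ τ : ℝ, 0 < τ → τ ≤ τ₀ → ∀ N : ℕ, 2 ≤ N → ((N : ℝ) - 1) * τ ≤ T →
      ∀ (P : ℕ → H1Zero D Ω) (F : ℕ → HCurlZero D Ω) (G : ℕ → HDivZero D Ω),
        IsTS4Solution ε μ τ N P F G →
        PositiveInnerProducts ε⁻¹ N (err τ p P) →
        PositiveInnerProducts ε N (err τ E F) →
        PositiveInnerProducts μ N (err τ H G) →
        wnorm ε⁻¹ (err τ p P (N - 1)) + wnorm ε (err τ E F (N - 1)) + wnorm μ (err τ H G (N - 1))
          ≤ C * (τ ^ 4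
            + wnorm ε⁻¹ (err τ p P 0) + wnorm ε (err τ E F 0) + wnorm μ (err τ H G 0)
            + wnorm ε⁻¹ (err τ p P 1) + wnorm ε (err τ E F 1) + wnorm μ (err τ H G 1)) := by
  obtain ⟨Kp, hKp0, hKp⟩ := exists_simpson_error_bound hT hp
  obtain ⟨KE, hKE0, hKE⟩ := exists_simpson_error_bound hT hE
  obtain ⟨KH, hKH0, hKH⟩ := exists_simpson_error_bound hT hH
  have hε' : 0 < ε⁻¹ := inv_pos.2 hε
  obtain ⟨K, hK⟩ : ∃ K, K = √ε⁻¹ * Kp + √ε * KE + √μ * KH := ⟨_, rfl⟩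
  have hK0 : 0 ≤ K := hK ▸ by positivity
  refine ⟨1, one_pos, 9 * K * T + 6, by positivity, ?_⟩
  intro τ hτ _ N hN hNT P F G hts hPp hPE hPH
  obtain ⟨m, rfl⟩ : ∃ m, N = m + 2 := ⟨N - 2, by omega⟩
  have hmT : ((m : ℝ) + 1) * τ ≤ T := by
    push_cast at hNT
    linarith
  have hnT : ∀ n < m, ((n : ℝ) + 2) * τ ≤ T := by
    intro n hn
    have : (n : ℝ) + 1 ≤ m := by exact_mod_cast hn
    exact (mul_le_mul_of_nonneg_right (by linarith) hτ.le).trans hmT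
  have hstab := norm_le_of_stepEnergy_identity (k := K * τ ^ 5) hε'.le hε.le hμ.le
    (x := err τ p P) (y := err τ E F) (z := err τ H G)
    (r := fun n => fld (simpsonDefect T p (n * τ) τ))
    (s := fun n => fld (simpsonDefect T E (n * τ) τ))
    (t := fun n => fld (simpsonDefect T H (n * τ) τ)) (m := m)
    (fun n hn => (hPp n (by omega)).trans_eq (winner_eq _ _ _))
    (fun n hn => (hPE n (by omega)).trans_eq (winner_eq _ _ _))
    (fun n hn => (hPH n (by omega)).trans_eq (winner_eq _ _ _)) ?_
    (fun n hn => energy_identity hε hT hsol hp hE hH hτ hts (by omega) (hnT n hn))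
  · simp only [wnorm_eq hε'.le, wnorm_eq hε.le, wnorm_eq hμ.le, show m + 2 - 1 = m + 1 by omega]
    refine hstab.trans ?_
    have hmK : (m : ℝ) * (3 * (K * τ ^ 5)) ≤ 3 * K * T * τ ^ 4 := by
      calc (m : ℝ) * (3 * (K * τ ^ 5)) = 3 * K * (m * τ) * τ ^ 4 := by ring
        _ ≤ 3 * K * T * τ ^ 4 := by
          gcongr
          linarith
    obtain ⟨S, hS⟩ : ∃ S, S = √ε⁻¹ * ‖err τ p P 0‖ + √ε * ‖err τ E F 0‖ + √μ * ‖err τ H G 0‖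
      + √ε⁻¹ * ‖err τ p P 1‖ + √ε * ‖err τ E F 1‖ + √μ * ‖err τ H G 1‖ := ⟨_, rfl⟩
    have hS0 : 0 ≤ S := hS ▸ by positivity
    have hτ4 : 0 ≤ τ ^ 4 := by positivity
    have hKTS : 0 ≤ K * T * S := by positivity
    calc _ ≤ 3 * (2 * S + 3 * K * T * τ ^ 4) := by linarith
      _ ≤ (9 * K * T + 6) * (τ ^ 4 + S) := by linarith
      _ = _ := by rw [hS]; ring
  · intro n hn
    have hn0 : 0 ≤ (n : ℝ) * τ := by positivity
    have hnT' : (n : ℝ) * τ + 2 * τ ≤ T := by linarith [hnT n hn]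
    have bp := (norm_fld_le _).trans (hKp (n * τ) τ hn0 hτ.le hnT')
    have bE := (norm_fld_le _).trans (hKE (n * τ) τ hn0 hτ.le hnT')
    have bH := (norm_fld_le _).trans (hKH (n * τ) τ hn0 hτ.le hnT')
    calc _ ≤ √ε⁻¹ * (Kp * τ ^ 5) + √ε * (KE * τ ^ 5) + √μ * (KH * τ ^ 5) :=
          add_le_add (add_le_add (mul_le_mul_of_nonneg_left bp (Real.sqrt_nonneg _))
            (mul_le_mul_of_nonneg_left bE (Real.sqrt_nonneg _)))
            (mul_le_mul_of_nonneg_left bH (Real.sqrt_nonneg _))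
      _ = K * τ ^ 5 := by rw [hK]; ring
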